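/- Let $\mathcal H_X,\mathcal H_A$ be finite-dimensional complex Hilbert spaces and let $\mathcal D(\mathcal H)$ denote the density operators on $\mathcal H$ (positive semi-definite, trace $1$). Let $\mathcal N$ be a quantum channel (completely positive, trace-preserving linear map) from operators on $\mathcal H_X\otimes\mathcal H_A$ to operators on $\mathcal H_X$, let $c$ be a Hermitian operator on $\mathcal H_X\otimes\mathcal H_A$, let $\beta\in[0,1)$ and $\rho_0\in\mathcal D(\mathcal H_X)$. Write $\langle a,b\rangle=\mathrm{Tr}(ab)$ for Hermitian $a,b$, let $\mathrm{Tr}_A$ be the partial trace over $\mathcal H_A$, let $\mathcal N^\dagger$ be the Hilbert–Schmidt adjoint of $\mathcal N$, and let $\succcurlyeq$ be the Löwner order. An open-loop policy is a sequence $\gamma=(\gamma_t)_{t\ge 0}$ of quantum channels from $\mathcal H_X$ to $\mathcal H_X\otimes\mathcal H_A$ with $\mathrm{Tr}_A(\gamma_t(\rho))=\rho$ for all $t$ and all $\rho\in\mathcal D(\mathcal H_X)$; it is stationary if $\gamma_t$ does not depend on $t$. Its discounted cost is $V(\gamma,\rho_0)=\sum_{t\ge 0}\beta^t\langle c,\sigma_t\rangle$,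 where $\sigma_t=\gamma_t(\rho_t)$ and $\rho_{t+1}=\mathcal N(\sigma_t)$ for $t\ge 0$. An open-loop policy is optimal (for $\rho_0$) if it attains the infimum of $V(\cdot,\rho_0)$ over all open-loop policies. Assumption. There is a Hermitian operator $\xi^*$ on $\mathcal H_X$ with $c+\beta\mathcal N^\dagger(\xi^*)\succcurlyeq\xi^*\otimes\mathrm{Id}$ such that, for every $\rho\in\mathcal D(\mathcal H_X)$, $$\min_{\pi\in\mathcal D(\mathcal H_A)}\langle c+\beta\mathcal N^\dagger(\xi^*),\rho\otimes\pi\rangle=\langle\xi^*,\rho\rangle .$$ Proposition. Under this Assumption, let $(\sigma^*,\pi^*)$ be an optimal solution of the bilinear program $$\min_{\sigma,\pi}\ \langle c,\sigma\rangle\quad\text{s.t.}\quad \mathrm{Tr}_A(\sigma)-\beta\,\mathcal N(\sigma)=(1-\beta)\rho_0,\ \ \sigma\succcurlyeq 0,\ \ \sigma=\mathrm{Tr}_A(\sigma)\otimes\pi,\ \ \mathrm{Tr}(\pi)=1,\ \ \pi\succcurlyeq 0,$$ over Hermitian operators $\sigma$ on $\mathcal H_X\otimes\mathcal H_A$ and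 $\pi$ on $\mathcal H_A$. Then the map $\gamma^*(\rho)=\rho\otimes\pi^*$, applied at every time $t$, is an optimal stationary open-loop policy for $\rho_0$. -/

import Mathlib

open scoped Kronecker ComplexOrder

namespace QMDP

/-- Linear operators on the finite-dimensional Hilbert space with orthonormal basis `X`.  The tensor
product of the spaces with bases `X` and `A` has basis `X × A`. -/
abbrev Op (X : Type*) : Type _ := Matrix X X ℂ

section Quantum

variable {X A m n : Type*} [Fintype X] [Fintype A] [Fintype m] [Fintype n]

/-- Density operators: positive semi-definite with unit trace. -/
def IsDensity (ρ : Op X) : Prop := ρ.PosSemidef ∧ ρ.trace = 1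

/-- The Hilbert–Schmidt pairing `⟨a, b⟩ = Tr (a b)` of Hermitian operators, as a real number (it is
real when `a` and `b` are Hermitian, see `hs_eq_trace`). -/
def hs (a b : Op X) : ℝ := (a * b).trace.re

theorem hs_eq_trace {a b : Op X} (ha : a.IsHermitian) (hb : b.IsHermitian) :
    ((hs a b : ℝ) : ℂ) = (a * b).trace := by
  have h : star (a * b).trace = (a * b).trace := by
    rw [← Matrix.trace_conjTranspose, Matrix.conjTranspose_mul, ha.eq, hb.eq, Matrix.trace_mul_comm]
  exact Complex.conj_eq_iff_re.mp h

/-- The partial trace over the second factor, `Tr_A = Id ⊗ Tr`. -/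
def partialTrace (X A : Type*) [Fintype A] : Op (X × A) →ₗ[ℂ] Op X where
  toFun σ := Matrix.of fun i j => ∑ a, σ (i, a) (j, a)
  map_add' σ τ := by ext i j; simp [Finset.sum_add_distrib]
  map_smul' z σ := by ext i j; simp [Finset.mul_sum]

/-- The ampliation `Φ ⊗ Id` of a super-operator by an environment with basis `E`. -/
def ampliation (Φ : Op m →ₗ[ℂ] Op n) (E : Type*) (M : Op (m × E)) : Op (n × E) :=
  Matrix.of fun p q => Φ (Matrix.of fun i j => M (i, p.2) (j, q.2)) p.1 q.1

/-- Quantum channels: completely positive and trace-preserving super-operators. -/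
structure IsChannel (Φ : Op m →ₗ[ℂ] Op n) : Prop where
  completelyPositive : ∀ (k : ℕ) (M : Op (m × Fin k)), M.PosSemidef →
    (ampliation Φ (Fin k) M).PosSemidef
  tracePreserving : ∀ M : Op m, (Φ M).trace = M.trace

/-- The adjoint `Φ†` of a super-operator with respect to the Hilbert–Schmidt inner product
`(Y, X) ↦ Tr (Yᴴ X)`; see `trace_hsAdjoint`. -/
def hsAdjoint [DecidableEq m] (Φ : Op m →ₗ[ℂ] Op n) (Y : Op n) : Op m :=
  Matrix.of fun i j => star (Y.conjTranspose * Φ (Matrix.single i j 1)).trace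

theorem trace_hsAdjoint [DecidableEq m] (Φ : Op m →ₗ[ℂ] Op n) (Y : Op n) (M : Op m) :
    ((hsAdjoint Φ Y).conjTranspose * M).trace = (Y.conjTranspose * Φ M).trace := by
  have h : ∀ i j, M i j • Matrix.single i j (1 : ℂ) = Matrix.single i j (M i j) := by
    intro i j; simp
  conv_rhs => rw [Matrix.matrix_eq_sum_single M]
  simp only [map_sum, Matrix.mul_sum, Matrix.trace_sum, ← h, map_smul, Matrix.mul_smul,
    Matrix.trace_smul]
  rw [Finset.sum_comm]
  simp [Matrix.trace, Matrix.mul_apply, hsAdjoint, mul_comm]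

/-- The appending map `ρ ↦ ρ ⊗ π`. -/
def append (X : Type*) {A : Type*} (π : Op A) : Op X →ₗ[ℂ] Op (X × A) where
  toFun ρ := ρ ⊗ₖ π
  map_add' ρ τ := Matrix.add_kronecker ρ τ π
  map_smul' z ρ := Matrix.smul_kronecker z ρ π

end Quantum

/-- The data of a quantum Markov decision process: the transition channel `N` and the Hermitian
one-stage cost operator `c`. -/
structure Model (X A : Type*) [Fintype X] [Fintype A] where
  N : Op (X × A) →ₗ[ℂ] Op X
  isChannel : IsChannel N
  c : Op (X × A)
  isHermitian : c.IsHermitian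

/-- A Markov policy is a sequence of super-operators `γ t` from `X` to `X × A` that are channels. -/
abbrev Policy (X A : Type*) : Type _ := ℕ → (Op X →ₗ[ℂ] Op (X × A))

section Dynamics

variable {X A : Type*} [Fintype X] [Fintype A]

/-- Open-loop policies: sequences of quantum channels `γ t` that are inverted by the partial trace,
`Tr_A (γ t ρ) = ρ` for every density operator `ρ`. -/
def IsOpenLoop (γ : Policy X A) : Prop :=
  ∀ t, IsChannel (γ t) ∧ ∀ ρ : Op X, IsDensity ρ → partialTrace X A (γ t ρ) = ρ

def IsStationary (γ : Policy X A) : Prop := ∀ t t', γ t = γ t'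

namespace Model

variable (𝓜 : Model X A)

/-- The state sequence `ρ_{t+1} = N (σ_t)` with `σ_t = γ_t (ρ_t)`, started at `ρ₀`. -/
def state (γ : Policy X A) (ρ₀ : Op X) : ℕ → Op X
  | 0 => ρ₀
  | t + 1 => 𝓜.N (γ t (state γ ρ₀ t))

/-- The action sequence `σ_t = γ_t (ρ_t)`. -/
def action (γ : Policy X A) (ρ₀ : Op X) (t : ℕ) : Op (X × A) := γ t (𝓜.state γ ρ₀ t)

/-- The discounted cost `V(γ, ρ₀) = ∑ₜ βᵗ ⟨c, σ_t⟩`; the series converges for every policy made of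
channels, see `summable_cost`. -/
noncomputable def cost (β : ℝ) (γ : Policy X A) (ρ₀ : Op X) : ℝ :=
  ∑' t : ℕ, β ^ t * hs 𝓜.c (𝓜.action γ ρ₀ t)

/-- An open-loop policy is optimal for `ρ₀` if its cost is the minimum (hence the infimum) of the
costs of all open-loop policies. -/
def IsOptimalOpenLoop (β : ℝ) (ρ₀ : Op X) (γ : Policy X A) : Prop :=
  IsOpenLoop γ ∧ IsLeast {v | ∃ γ' : Policy X A, IsOpenLoop γ' ∧ 𝓜.cost β γ' ρ₀ = v} (𝓜.cost β γ ρ₀)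

/-- `T(σ) = Tr_A(σ) - β N(σ)`. -/
def T (β : ℝ) (σ : Op (X × A)) : Op X := partialTrace X A σ - (β : ℂ) • 𝓜.N σ

/-- Feasibility for the primal SDP: `σ` Hermitian, `T(σ) = (1 - β) ρ₀` and `σ ≽ 0`. -/
def SDPFeasible (β : ℝ) (ρ₀ : Op X) (σ : Op (X × A)) : Prop :=
  σ.IsHermitian ∧ 𝓜.T β σ = ((1 - β : ℝ) : ℂ) • ρ₀ ∧ σ.PosSemidef

/-- Feasibility for the dual SDP: `ξ` Hermitian and `c + β N†(ξ) ≽ ξ ⊗ Id`. -/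
def DualFeasible [DecidableEq X] [DecidableEq A] (β : ℝ) (ξ : Op X) : Prop :=
  ξ.IsHermitian ∧ (𝓜.c + (β : ℂ) • hsAdjoint 𝓜.N ξ - ξ ⊗ₖ (1 : Op A)).PosSemidef

/-- There is a dual feasible `ξ` such that, for every density operator `ρ`, the minimum of
`⟨c + β N†(ξ), ρ ⊗ π⟩` over density operators `π` is `⟨ξ, ρ⟩`. -/
def DualTight [DecidableEq X] [DecidableEq A] (β : ℝ) : Prop :=
  ∃ ξ : Op X, 𝓜.DualFeasible β ξ ∧ ∀ ρ : Op X, IsDensity ρ →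
    IsLeast ((fun π : Op A => hs (𝓜.c + (β : ℂ) • hsAdjoint 𝓜.N ξ) (ρ ⊗ₖ π)) '' {π | IsDensity π})
      (hs ξ ρ)

/-- Feasibility for the bilinear program: the SDP constraints, together with
`σ = Tr_A(σ) ⊗ π`, `Tr π = 1` and `π ≽ 0`. -/
def BILFeasible (β : ℝ) (ρ₀ : Op X) (σ : Op (X × A)) (π : Op A) : Prop :=
  𝓜.SDPFeasible β ρ₀ σ ∧ π.IsHermitian ∧
    σ = partialTrace X A σ ⊗ₖ π ∧ π.trace = 1 ∧ π.PosSemidef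

/-- Optimal solutions of the bilinear program: minimize `⟨c, σ⟩` over feasible pairs. -/
def BILOptimal (β : ℝ) (ρ₀ : Op X) (σ : Op (X × A)) (π : Op A) : Prop :=
  𝓜.BILFeasible β ρ₀ σ π ∧
    ∀ (σ' : Op (X × A)) (π' : Op A), 𝓜.BILFeasible β ρ₀ σ' π' → hs 𝓜.c σ ≤ hs 𝓜.c σ'

end Model

end Dynamics

section WellDefined

variable {X A m n : Type*} [Fintype X] [Fintype A] [Fintype m] [Fintype n]

theorem IsChannel.isDensity {Φ : Op m →ₗ[ℂ] Op n} (hΦ : IsChannel Φ) {ρ : Op m}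
    (hρ : IsDensity ρ) : IsDensity (Φ ρ) := by
  refine ⟨?_, by rw [hΦ.tracePreserving, hρ.2]⟩
  have h := hΦ.completelyPositive 1 (ρ.submatrix Prod.fst Prod.fst) (hρ.1.submatrix _)
  exact h.submatrix (fun i : n => (i, (0 : Fin 1)))

theorem Model.isDensity_state (𝓜 : Model X A) {γ : Policy X A} (hγ : ∀ t, IsChannel (γ t))
    {ρ₀ : Op X} (hρ : IsDensity ρ₀) (t : ℕ) : IsDensity (𝓜.state γ ρ₀ t) := by
  induction t with
  | zero => exact hρ
  | succ t ih => exact 𝓜.isChannel.isDensity ((hγ t).isDensity ih)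

theorem IsDensity.norm_apply_le {ρ : Op X} (hρ : IsDensity ρ) (i j : X) : ‖ρ i j‖ ≤ 1 := by
  have hd : ∀ k, 0 ≤ ρ k k := fun k => hρ.1.diag_nonneg
  have hle : ∀ k, ρ k k ≤ 1 := fun k => by
    rw [← hρ.2]
    exact Finset.single_le_sum (f := fun l => ρ l l) (fun l _ => hd l) (Finset.mem_univ k)
  have hdet := (hρ.1.submatrix ![i, j]).det_nonneg
  rw [Matrix.det_fin_two] at hdet
  simp only [Matrix.submatrix_apply, Matrix.cons_val_zero, Matrix.cons_val_one] at hdet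
  have hji : ρ j i = star (ρ i j) := (hρ.1.1.apply j i).symm
  have hsq : ρ i j * ρ j i = ((‖ρ i j‖ ^ 2 : ℝ) : ℂ) := by
    rw [hji]
    simpa using Complex.mul_conj' (ρ i j)
  have h1 : ρ i j * ρ j i ≤ 1 := by
    have : ρ i i * ρ j j ≤ 1 * 1 := mul_le_mul (hle i) (hle j) (hd j) zero_le_one
    rw [one_mul] at this
    exact (sub_nonneg.mp hdet).trans this
  rw [hsq] at h1
  have h2 : ‖ρ i j‖ ^ 2 ≤ 1 := by exact_mod_cast h1
  nlinarith [norm_nonneg (ρ i j)]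

theorem Model.summable_cost (𝓜 : Model X A) {β : ℝ} (h0 : 0 ≤ β) (h1 : β < 1) {γ : Policy X A}
    (hγ : ∀ t, IsChannel (γ t)) {ρ₀ : Op X} (hρ : IsDensity ρ₀) :
    Summable fun t : ℕ => β ^ t * hs 𝓜.c (𝓜.action γ ρ₀ t) := by
  set C : ℝ := ∑ i, ∑ j, ‖𝓜.c i j‖
  refine Summable.of_norm_bounded
    ((summable_geometric_of_lt_one h0 h1).mul_right C) fun t => ?_
  have hσ : IsDensity (𝓜.action γ ρ₀ t) := (hγ t).isDensity (𝓜.isDensity_state hγ hρ t)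
  rw [norm_mul, norm_pow, Real.norm_of_nonneg h0]
  refine mul_le_mul_of_nonneg_left ?_ (pow_nonneg h0 t)
  refine (Complex.abs_re_le_norm _).trans ?_
  simp only [Matrix.trace, Matrix.diag, Matrix.mul_apply]
  refine (norm_sum_le _ _).trans (Finset.sum_le_sum fun i _ => ?_)
  refine (norm_sum_le _ _).trans (Finset.sum_le_sum fun j _ => ?_)
  rw [norm_mul]
  exact mul_le_of_le_one_right (norm_nonneg _) (hσ.norm_apply_le j i)

end WellDefined

end QMDP

open scoped Kronecker ComplexOrder

namespace QMDP

/-! ### Partial trace -/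

section PartialTrace

variable {X A : Type*} [Fintype A]

/-! The proof is linear programming duality plus one rank argument. Pairing the positive slack `c +
β N†(ξ) - ξ ⊗ 1` with each action and telescoping shows that `⟨ξ, ρ₀⟩` bounds every open-loop cost
from below (`hs_le_cost`). On the other side, a bilinear feasible pair has value `(1 - β)` times the
cost of appending its `π` (`BILFeasible.hs_cost_eq`).

It remains to find a feasible pair of value `(1 - β) ⟨ξ, ρ₀⟩`. Tightness at the maximally mixed
state makes the slack orthogonal to `1 ⊗ π'` for some density `π'`; both being positive, their
product vanishes, so the slack annihilates every `τ ⊗ π'` (`DualTight.exists_isDensity`). The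
discounted occupation of `π'` is feasible (`exists_BILFeasible`) and attains that value. -/

theorem posSemidef_partialTrace {σ : Op (X × A)} (hσ : σ.PosSemidef) :
    (partialTrace X A σ).PosSemidef := by
  have h : partialTrace X A σ = ∑ a : A, σ.submatrix (fun i => (i, a)) (fun i => (i, a)) := by
    ext i j
    simp [partialTrace, Matrix.sum_apply]
  rw [h]
  exact Matrix.posSemidef_sum _ fun a _ => hσ.submatrix _

theorem partialTrace_kronecker (ρ : Op X) (π : Op A) :
    partialTrace X A (ρ ⊗ₖ π) = π.trace • ρ := by
  ext i j
  simp [partialTrace, Matrix.trace, mul_comm, Finset.mul_sum]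

end PartialTrace

/-! ### Positivity, appending channels and convergence -/

section Operators

variable {X A : Type*} [Fintype X] [Fintype A]

theorem hs_sub_right (a b b' : Op X) : hs a (b - b') = hs a b - hs a b' := by
  simp [hs, Matrix.mul_sub]

theorem hs_smul_right (a b : Op X) (r : ℝ) : hs a ((r : ℂ) • b) = r * hs a b := by
  simp [hs]

theorem hs_add_left (a a' b : Op X) : hs (a + a') b = hs a b + hs a' b := by
  simp [hs, Matrix.add_mul]

theorem hs_sub_left (a a' b : Op X) : hs (a - a') b = hs a b - hs a' b := by
  simp [hs, Matrix.sub_mul]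

theorem exists_eq_conjTranspose_mul_self {P : Op X} (hP : P.PosSemidef) :
    ∃ B : Op X, P = B.conjTranspose * B := by
  classical
  open scoped MatrixOrder in
  exact CStarAlgebra.nonneg_iff_eq_star_mul_self.mp hP.nonneg

/-- Cyclicity of the trace exhibits the pairing of two positive operators as a squared
Hilbert–Schmidt norm, which gives both its sign and its vanishing case. -/
theorem trace_mul_eq_trace_self_mul_conjTranspose (B D : Op X) :
    (B.conjTranspose * B * (D.conjTranspose * D)).trace =
      (B * D.conjTranspose * (B * D.conjTranspose).conjTranspose).trace := by
  rw [Matrix.conjTranspose_mul, Matrix.conjTranspose_conjTranspose, Matrix.mul_assoc,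
    Matrix.trace_mul_comm]
  simp only [Matrix.mul_assoc]

theorem trace_mul_nonneg {P R : Op X} (hP : P.PosSemidef) (hR : R.PosSemidef) :
    0 ≤ (P * R).trace := by
  obtain ⟨B, rfl⟩ := exists_eq_conjTranspose_mul_self hP
  obtain ⟨D, rfl⟩ := exists_eq_conjTranspose_mul_self hR
  rw [trace_mul_eq_trace_self_mul_conjTranspose]
  exact (Matrix.posSemidef_self_mul_conjTranspose _).trace_nonneg

theorem hs_nonneg {P R : Op X} (hP : P.PosSemidef) (hR : R.PosSemidef) : 0 ≤ hs P R :=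
  (Complex.le_def.mp (trace_mul_nonneg hP hR)).1

/-- Positive semi-definite operators that are orthogonal have product zero. -/
theorem mul_eq_zero_of_hs_eq_zero {P R : Op X} (hP : P.PosSemidef) (hR : R.PosSemidef)
    (h : hs P R = 0) : P * R = 0 := by
  have ht : (P * R).trace = 0 := by rw [← hs_eq_trace hP.1 hR.1, h, Complex.ofReal_zero]
  obtain ⟨B, rfl⟩ := exists_eq_conjTranspose_mul_self hP
  obtain ⟨D, rfl⟩ := exists_eq_conjTranspose_mul_self hR
  rw [trace_mul_eq_trace_self_mul_conjTranspose,
    Matrix.trace_mul_conjTranspose_self_eq_zero_iff] at ht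
  rw [Matrix.mul_assoc, ← Matrix.mul_assoc B, ht, Matrix.zero_mul, Matrix.mul_zero]

theorem posSemidef_of_hasSum {f : ℕ → Op X} {S : Op X} (h : HasSum f S)
    (hf : ∀ t, (f t).PosSemidef) : S.PosSemidef := by
  refine .of_dotProduct_mulVec_nonneg ?_ fun x => ?_
  · have hH := h.matrix_conjTranspose
    simp only [fun t => (hf t).1.eq] at hH
    exact hH.unique h
  · have hq := h.map (AddMonoidHom.mk' (fun M : Op X => star x ⬝ᵥ M.mulVec x)
      (fun M N => by simp [Matrix.add_mulVec, dotProduct_add])) (by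
        change Continuous fun M : Op X => star x ⬝ᵥ M.mulVec x
        fun_prop)
    exact hq.nonneg fun t => (hf t).dotProduct_mulVec_nonneg x

theorem trace_partialTrace (σ : Op (X × A)) : (partialTrace X A σ).trace = σ.trace := by
  simp [partialTrace, Matrix.trace, Fintype.sum_prod_type]

theorem hs_kronecker_one [DecidableEq A] (ξ : Op X) (σ : Op (X × A)) :
    hs (ξ ⊗ₖ (1 : Op A)) σ = hs ξ (partialTrace X A σ) := by
  simp only [hs, Matrix.trace, Matrix.diag, Matrix.mul_apply, partialTrace, LinearMap.coe_mk,
    AddHom.coe_mk, Matrix.of_apply, Fintype.sum_prod_type, Matrix.kronecker_apply,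
    Matrix.one_apply, mul_ite, mul_one, mul_zero, ite_mul, zero_mul, Finset.sum_ite_eq,
    Finset.mem_univ, if_true, Finset.mul_sum]
  congr 1
  exact Finset.sum_congr rfl fun i _ => Finset.sum_comm

/-- Up to regrouping indices, the ampliation sends `M` to `M ⊗ π`. -/
theorem isChannel_append {π : Op A} (hπ : IsDensity π) : IsChannel (append X π) where
  completelyPositive k M hM :=
    (hM.kronecker hπ.1).submatrix
      (fun p : (X × A) × Fin k => ((p.1.1, p.2), p.1.2))
  tracePreserving M := by
    change (M ⊗ₖ π).trace = _
    rw [Matrix.trace_kronecker, hπ.2, mul_one]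

theorem isOpenLoop_append {π : Op A} (hπ : IsDensity π) :
    IsOpenLoop (fun _ => append X π : Policy X A) := fun _ =>
  ⟨isChannel_append hπ, fun ρ _ => by
    change partialTrace X A (ρ ⊗ₖ π) = ρ
    rw [partialTrace_kronecker, hπ.2, one_smul]⟩

theorem IsDensity.abs_hs_le {ρ : Op X} (hρ : IsDensity ρ) (a : Op X) :
    |hs a ρ| ≤ ∑ i, ∑ j, ‖a i j‖ := by
  refine (Complex.abs_re_le_norm _).trans ?_
  simp only [Matrix.trace, Matrix.diag, Matrix.mul_apply]
  refine (norm_sum_le _ _).trans (Finset.sum_le_sum fun i _ => ?_)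
  refine (norm_sum_le _ _).trans (Finset.sum_le_sum fun j _ => ?_)
  rw [norm_mul]
  exact mul_le_of_le_one_right (norm_nonneg _) (hρ.norm_apply_le j i)

theorem summable_geometric_mul_hs {β : ℝ} (h0 : 0 ≤ β) (h1 : β < 1) (a : Op X) {ρ : ℕ → Op X}
    (hρ : ∀ t, IsDensity (ρ t)) : Summable fun t => β ^ t * hs a (ρ t) := by
  refine Summable.of_norm_bounded
    ((summable_geometric_of_lt_one h0 h1).mul_right (∑ i, ∑ j, ‖a i j‖)) fun t => ?_
  rw [norm_mul, norm_pow, Real.norm_of_nonneg h0]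
  exact mul_le_mul_of_nonneg_left ((hρ t).abs_hs_le a) (pow_nonneg h0 t)

theorem summable_geometric_smul {β : ℝ} (h0 : 0 ≤ β) (h1 : β < 1) {ρ : ℕ → Op X}
    (hρ : ∀ t, IsDensity (ρ t)) : Summable fun t => ((β ^ t : ℝ) : ℂ) • ρ t := by
  refine Pi.summable.mpr fun i => Pi.summable.mpr fun j => ?_
  refine Summable.of_norm_bounded (summable_geometric_of_lt_one h0 h1) fun t => ?_
  rw [Matrix.smul_apply, norm_smul, Complex.norm_real, norm_pow, Real.norm_of_nonneg h0]
  exact mul_le_of_le_one_right (pow_nonneg h0 t) ((hρ t).norm_apply_le i j)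

end Operators

/-- The sum is the discounted series of `u` minus its own tail from index `1`. -/
theorem hasSum_discounted_telescope {β : ℝ} {u : ℕ → ℝ} (h : Summable fun t => β ^ t * u t) :
    HasSum (fun t => β ^ t * (u t - β * u (t + 1))) (u 0) := by
  have h' := (hasSum_nat_add_iff' 1).mpr h.hasSum
  have := h.hasSum.sub h'
  rw [sub_sub_cancel, Finset.sum_range_one, pow_zero, one_mul] at this
  have hterm : ∀ t, β ^ t * (u t - β * u (t + 1)) = β ^ t * u t - β ^ (t + 1) * u (t + 1) :=
    fun t => by ring
  rwa [funext hterm]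

/-! ### Duality and occupation operators -/

namespace Model

variable {X A : Type*} [Fintype X] [Fintype A] (𝓜 : Model X A)

theorem T_append {π : Op A} (hπ : π.trace = 1) (β : ℝ) (ρ : Op X) :
    𝓜.T β (append X π ρ) = ρ - (β : ℂ) • 𝓜.N (append X π ρ) := by
  change partialTrace X A (ρ ⊗ₖ π) - _ = _
  rw [partialTrace_kronecker, hπ, one_smul]

/-- The slack of a dual feasible `ξ` pairs with `σ` to the gap between primal and dual values. -/
theorem hs_dualSlack [DecidableEq X] [DecidableEq A] {β : ℝ} {ξ : Op X}
    (hξ : 𝓜.DualFeasible β ξ) (σ : Op (X × A)) :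
    hs (𝓜.c + (β : ℂ) • hsAdjoint 𝓜.N ξ - ξ ⊗ₖ (1 : Op A)) σ = hs 𝓜.c σ - hs ξ (𝓜.T β σ) := by
  -- Hermiticity is read off from the slack, which is positive; it removes the conjugate transpose
  -- in `trace_hsAdjoint`.
  have hK : ((β : ℂ) • hsAdjoint 𝓜.N ξ).IsHermitian := by
    have h1 : (ξ ⊗ₖ (1 : Op A)).IsHermitian := by
      rw [Matrix.IsHermitian, Matrix.conjTranspose_kronecker, hξ.1.eq, Matrix.conjTranspose_one]
    have h := (hξ.2.1.add h1).sub 𝓜.isHermitian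
    rwa [sub_add_cancel, add_sub_cancel_left] at h
  have hN : hs ((β : ℂ) • hsAdjoint 𝓜.N ξ) σ = β * hs ξ (𝓜.N σ) := by
    have h := trace_hsAdjoint 𝓜.N ξ σ
    rw [hξ.1.eq] at h
    rw [hs, ← hK.eq, Matrix.conjTranspose_smul, Matrix.smul_mul, Matrix.trace_smul, h]
    simp [hs]
  rw [hs_sub_left, hs_add_left, hN, hs_kronecker_one, T, hs_sub_right, hs_smul_right]
  ring

/-- Weak duality: a dual feasible `ξ` bounds the cost of every open-loop policy from below. -/
theorem hs_le_cost [DecidableEq X] [DecidableEq A] {β : ℝ} (h0 : 0 ≤ β) (h1 : β < 1) {ξ : Op X}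
    (hξ : 𝓜.DualFeasible β ξ) {ρ₀ : Op X} (hρ₀ : IsDensity ρ₀) {γ : Policy X A}
    (hγ : IsOpenLoop γ) : hs ξ ρ₀ ≤ 𝓜.cost β γ ρ₀ := by
  have hch := fun t => (hγ t).1
  have hst := 𝓜.isDensity_state hch hρ₀
  have hu := hasSum_discounted_telescope (summable_geometric_mul_hs h0 h1 ξ hst)
  refine hasSum_le (fun t => ?_) hu (𝓜.summable_cost h0 h1 hch hρ₀).hasSum
  refine mul_le_mul_of_nonneg_left ?_ (pow_nonneg h0 t)
  have hT : 𝓜.T β (𝓜.action γ ρ₀ t) =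
      𝓜.state γ ρ₀ t - (β : ℂ) • 𝓜.state γ ρ₀ (t + 1) := by
    rw [T, action, (hγ t).2 _ (hst t), state]
  have h := hs_nonneg hξ.2 ((hch t).isDensity (hst t)).1
  rw [← action, hs_dualSlack 𝓜 hξ, hT, hs_sub_right, hs_smul_right] at h
  linarith

/-- A bilinear feasible pair has value `(1 - β)` times the cost of the induced policy. -/
theorem BILFeasible.hs_cost_eq {𝓜 : Model X A} {β : ℝ} (h0 : 0 ≤ β) (h1 : β < 1) {ρ₀ : Op X}
    (hρ₀ : IsDensity ρ₀) {σ : Op (X × A)} {π : Op A} (h : 𝓜.BILFeasible β ρ₀ σ π) :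
    hs 𝓜.c σ = (1 - β) * 𝓜.cost β (fun _ => append X π) ρ₀ := by
  obtain ⟨⟨-, hT, hσ⟩, -, hprod, htr, hπ⟩ := h
  have hch : ∀ _ : ℕ, IsChannel (append X π) := fun _ => isChannel_append ⟨hπ, htr⟩
  set γ : Policy X A := fun _ => append X π
  set τ := partialTrace X A σ with hτ
  have hτd : IsDensity τ := by
    refine ⟨posSemidef_partialTrace hσ, ?_⟩
    have ht := congrArg Matrix.trace hT
    rw [T, Matrix.trace_sub, Matrix.trace_smul, Matrix.trace_smul, 𝓜.isChannel.tracePreserving,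
      hρ₀.2, ← trace_partialTrace, ← hτ, smul_eq_mul, smul_eq_mul] at ht
    have hne : ((1 - β : ℝ) : ℂ) ≠ 0 := by exact_mod_cast (sub_pos.mpr h1).ne'
    apply mul_left_cancel₀ hne
    rw [← ht]
    push_cast
    ring
  -- The SDP constraint is the case `t = 0`; the linear map `N ∘ append X π` carries it along the
  -- trajectories started at `τ` and `ρ₀`.
  have hrec : ∀ t, 𝓜.state γ τ t - (β : ℂ) • 𝓜.state γ τ (t + 1) =
      ((1 - β : ℝ) : ℂ) • 𝓜.state γ ρ₀ t := by
    intro t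
    induction t with
    | zero =>
      have : 𝓜.state γ τ 1 = 𝓜.N σ := congrArg 𝓜.N hprod.symm
      rw [this]
      exact hT
    | succ t ih =>
      have := congrArg (fun ρ => 𝓜.N (append X π ρ)) ih
      simp only [map_sub, map_smul] at this
      exact this
  have hact : ∀ t, hs 𝓜.c (𝓜.action γ τ t) - β * hs 𝓜.c (𝓜.action γ τ (t + 1)) =
      (1 - β) * hs 𝓜.c (𝓜.action γ ρ₀ t) := by
    intro t
    have := congrArg (append X π) (hrec t)
    rw [map_sub, map_smul, map_smul] at this
    rw [← hs_smul_right, ← hs_smul_right, ← hs_sub_right]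
    exact congrArg (hs 𝓜.c) this
  have hsum := hasSum_discounted_telescope (𝓜.summable_cost h0 h1 hch hτd)
  have h0' : 𝓜.action γ τ 0 = σ := hprod.symm
  rw [h0', funext fun t => congrArg (β ^ t * ·) (hact t)] at hsum
  have hsum' := (𝓜.summable_cost h0 h1 hch hρ₀).hasSum.mul_left (1 - β)
  simp only [mul_left_comm (1 - β)] at hsum'
  exact hsum.unique hsum'

/-- For every density operator `π` the discounted occupation `σ` of the policy `ρ ↦ ρ ⊗ π`
is feasible for the bilinear program. -/
theorem exists_BILFeasible {β : ℝ} (h0 : 0 ≤ β) (h1 : β < 1) {ρ₀ : Op X}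
    (hρ₀ : IsDensity ρ₀) {π : Op A} (hπ : IsDensity π) :
    ∃ τ : Op X, 𝓜.BILFeasible β ρ₀ (append X π τ) π := by
  have hch : ∀ _ : ℕ, IsChannel (append X π) := fun _ => isChannel_append hπ
  set γ : Policy X A := fun _ => append X π
  have hst := 𝓜.isDensity_state hch hρ₀
  obtain ⟨S, hS⟩ := summable_geometric_smul h0 h1 hst
  have hSpos : S.PosSemidef := posSemidef_of_hasSum hS fun t =>
    (hst t).1.smul (by exact_mod_cast pow_nonneg h0 t)
  -- Applying `β N ∘ append X π` to the series `S = ∑ βᵗ ρ_t` shifts it by one step, so only the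
  -- term `ρ₀` survives.
  have hrec : S - (β : ℂ) • 𝓜.N (append X π S) = ρ₀ := by
    have hL := hS.map ((β : ℂ) • (𝓜.N ∘ₗ append X π))
      (LinearMap.continuous_of_finiteDimensional _)
    have hL' := (hasSum_nat_add_iff' 1).mpr hS
    have hstep : (⇑((β : ℂ) • (𝓜.N ∘ₗ append X π)) ∘ fun t => ((β ^ t : ℝ) : ℂ) • 𝓜.state γ ρ₀ t) =
        fun t => ((β ^ (t + 1) : ℝ) : ℂ) • 𝓜.state γ ρ₀ (t + 1) := by
      funext t
      change (β : ℂ) • 𝓜.N (append X π (((β ^ t : ℝ) : ℂ) • 𝓜.state γ ρ₀ t)) =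
        ((β ^ (t + 1) : ℝ) : ℂ) • 𝓜.N (append X π (𝓜.state γ ρ₀ t))
      rw [map_smul, map_smul, smul_smul, pow_succ', Complex.ofReal_mul]
    rw [hstep] at hL
    have hfix : (β : ℂ) • 𝓜.N (append X π S) = S - _ := hL.unique hL'
    rw [hfix, sub_sub_cancel, Finset.sum_range_one, pow_zero, Complex.ofReal_one, one_smul, state]
  have hpos : (append X π (((1 - β : ℝ) : ℂ) • S)).PosSemidef :=
    (hSpos.smul (by exact_mod_cast (sub_pos.mpr h1).le)).kronecker hπ.1
  refine ⟨((1 - β : ℝ) : ℂ) • S, ⟨hpos.1, ?_, hpos⟩, hπ.1.1, ?_, hπ.2, hπ.1⟩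
  · rw [T_append 𝓜 hπ.2, map_smul, map_smul, smul_comm, ← smul_sub, hrec]
  · change append X π _ = partialTrace X A (_ ⊗ₖ π) ⊗ₖ π
    rw [partialTrace_kronecker, hπ.2, one_smul]
    rfl

/-- Tightness at the maximally mixed state gives one `π` that closes the duality gap at every
operator. -/
theorem DualTight.exists_isDensity [DecidableEq X] [DecidableEq A] [Nonempty X]
    {𝓜 : Model X A} {β : ℝ} (h : 𝓜.DualTight β) :
    ∃ ξ : Op X, 𝓜.DualFeasible β ξ ∧ ∃ π : Op A, IsDensity π ∧
      ∀ τ : Op X, hs 𝓜.c (append X π τ) = hs ξ (𝓜.T β (append X π τ)) := by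
  obtain ⟨ξ, hξ, hmin⟩ := h
  refine ⟨ξ, hξ, ?_⟩
  -- The maximally mixed state is a multiple of the identity, so the `π` found there serves every
  -- `τ`.
  set r : ℝ := (Fintype.card X : ℝ)⁻¹
  have hr : 0 < r := inv_pos.mpr (by exact_mod_cast Fintype.card_pos)
  have hm : IsDensity ((r : ℂ) • (1 : Op X)) := by
    refine ⟨Matrix.PosSemidef.one.smul (by exact_mod_cast hr.le), ?_⟩
    simp [r]
  obtain ⟨⟨π, hπ, heq⟩, -⟩ := hmin _ hm
  refine ⟨π, hπ, fun τ => ?_⟩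
  set Q := 𝓜.c + (β : ℂ) • hsAdjoint 𝓜.N ξ - ξ ⊗ₖ (1 : Op A) with hQ
  have h1 : hs Q (((r : ℂ) • (1 : Op X)) ⊗ₖ π) = 0 := by
    rw [hQ, hs_sub_left, hs_kronecker_one, partialTrace_kronecker, hπ.2, one_smul]
    exact sub_eq_zero.mpr heq
  rw [Matrix.smul_kronecker, hs_smul_right] at h1
  have h2 : Q * ((1 : Op X) ⊗ₖ π) = 0 := mul_eq_zero_of_hs_eq_zero hξ.2
    (Matrix.PosSemidef.one.kronecker hπ.1) ((mul_eq_zero.mp h1).resolve_left hr.ne')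
  -- Factoring out `1 ⊗ π` on the left lets `Q` kill it, with no positivity of `τ`.
  have h3 : τ ⊗ₖ π = ((1 : Op X) ⊗ₖ π) * (τ ⊗ₖ (1 : Op A)) := by
    rw [← Matrix.mul_kronecker_mul, Matrix.one_mul, Matrix.mul_one]
  rw [← sub_eq_zero, ← hs_dualSlack 𝓜 hξ, ← hQ]
  change hs Q (τ ⊗ₖ π) = 0
  rw [h3, hs, ← Matrix.mul_assoc, h2, Matrix.zero_mul, Matrix.trace_zero, Complex.zero_re]

end Model

end QMDP

theorem mainTheorem8 {X A : Type*} [Fintype X] [DecidableEq X] [Fintype A] [DecidableEq A]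
    (𝓜 : QMDP.Model X A) (β : ℝ) (hβ0 : 0 ≤ β) (hβ1 : β < 1)
    (hdual : 𝓜.DualTight β)
    (ρ₀ : QMDP.Op X) (hρ₀ : QMDP.IsDensity ρ₀)
    (σ : QMDP.Op (X × A)) (π : QMDP.Op A) (hopt : 𝓜.BILOptimal β ρ₀ σ π) :
    QMDP.IsStationary (fun _ => QMDP.append X π : QMDP.Policy X A) ∧
      𝓜.IsOptimalOpenLoop β ρ₀ (fun _ => QMDP.append X π) := by
  have hπ : QMDP.IsDensity π := ⟨hopt.1.2.2.2.2, hopt.1.2.2.2.1⟩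
  have hOL := QMDP.isOpenLoop_append (X := X) hπ
  refine ⟨fun _ _ => rfl, hOL, ⟨_, hOL, rfl⟩, ?_⟩
  rintro v ⟨γ, hγ, rfl⟩
  have : Nonempty X := by
    by_contra hX
    rw [not_nonempty_iff] at hX
    simpa [Matrix.trace] using hρ₀.2
  obtain ⟨ξ, hξ, π', hπ', hgap⟩ := hdual.exists_isDensity
  refine le_trans ?_ (𝓜.hs_le_cost hβ0 hβ1 hξ hρ₀ hγ)
  obtain ⟨τ, hτ⟩ := 𝓜.exists_BILFeasible hβ0 hβ1 hρ₀ hπ'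
  have hle := hopt.2 _ _ hτ
  -- Both sides of `hle` now carry the factor `1 - β`: the cost of `π` on the left, `⟨ξ, ρ₀⟩` on the
  -- right.
  rw [hopt.1.hs_cost_eq hβ0 hβ1 hρ₀, hgap, hτ.1.2.1, QMDP.hs_smul_right] at hle
  exact le_of_mul_le_mul_left hle (sub_pos.mpr hβ1)
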